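/- Let $Y$ and $U$ be (real or complex) Hilbert spaces over the same field, let $A:D(A)\subset Y\to Y$ generate a $C_0$-semigroup $\{S(t)\}_{t\ge 0}$ on $Y$, and let $B\in\mathcal L(U;Y)$. Consider the control system $y'(t)=Ay(t)+Bu(t)$, $t>0$. For $T>0$ let $(H_Tf)(t):=f([t/T]\,T)$, where $[\cdot]$ denotes the integer part. The system is called $(\mathrm{DC})_T$-stabilizable if there is $F\in\mathcal L(Y;U)$ such that the closed-loop system $$y'(t)=Ay(t)+BF(H_Ty)(t),\qquad t>0,$$ is exponentially stable, i.e. there are constants $M$ and $\omega>0$ such that for every $y_0\in Y$ the (mild) solution $y\in C([0,+\infty);Y)$ with $y(0)=y_0$, i.e. the solution of $$y(t)=S(t)y_0+\int_0^tS(t-s)BF(H_Ty)(s)\,ds,\qquad t\ge 0,$$ satisfies $\|y(t)\|_Y\le Me^{-\omega t}\|y_0\|_Y$ for all $t\ge 0$. Then the set $$\mathcal T:=\{T\in\mathbb R^+:\ \text{the system is }(\mathrm{DC})_T\text{-stabilizable}\}$$ is an open subset of $\mathbb R^+=(0,+\infty)$. -/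

import Mathlib

/-- A `C₀`-semigroup of bounded linear operators on `Y`. The family is indexed by `ℝ`, but only
the operators `S t` with `0 ≤ t` are meaningful: nothing is required at negative times, and
negative times are never used. -/
structure C0Semigroup (𝕜 Y : Type*) [RCLike 𝕜] [NormedAddCommGroup Y] [NormedSpace 𝕜 Y] where
  toFun : ℝ → Y →L[𝕜] Y
  map_zero' : toFun 0 = ContinuousLinearMap.id 𝕜 Y
  map_add' : ∀ s t : ℝ, 0 ≤ s → 0 ≤ t → toFun (s + t) = (toFun s).comp (toFun t)
  continuousOn_orbit' : ∀ x : Y, ContinuousOn (fun t => toFun t x) (Set.Ici 0)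

namespace C0Semigroup

instance {𝕜 Y : Type*} [RCLike 𝕜] [NormedAddCommGroup Y] [NormedSpace 𝕜 Y] :
    CoeFun (C0Semigroup 𝕜 Y) (fun _ => ℝ → Y →L[𝕜] Y) where
  coe := toFun

/-- The (possibly unbounded) operator `A`, with domain `D(A) = A.domain`, is the infinitesimal
generator of `S`: one has `x ∈ D(A)` and `A x = z` if and only if
`(S h x - x) / h → z` as `h ↓ 0`. -/
def IsGeneratedBy {𝕜 Y : Type*} [RCLike 𝕜] [NormedAddCommGroup Y] [NormedSpace 𝕜 Y]
    (S : C0Semigroup 𝕜 Y) (A : Y →ₗ.[𝕜] Y) : Prop :=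
  ∀ x z : Y, (x, z) ∈ A.graph ↔
    Filter.Tendsto (fun h : ℝ => ((h : 𝕜))⁻¹ • (S h x - x)) (nhdsWithin 0 (Set.Ioi 0)) (nhds z)

/-- `y` is the (mild) solution on `[0, ∞)` of `y' = A y + f`, `y 0 = y₀`, where `A` is the
generator of `S`: it is continuous and satisfies the variation of constants formula. -/
def IsMildSolution {𝕜 Y : Type*} [RCLike 𝕜] [NormedAddCommGroup Y] [NormedSpace 𝕜 Y]
    [NormedSpace ℝ Y] (S : C0Semigroup 𝕜 Y) (f : ℝ → Y) (y₀ : Y) (y : ℝ → Y) : Prop :=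
  ContinuousOn y (Set.Ici 0) ∧
    ∀ t : ℝ, 0 ≤ t → y t = S t y₀ + ∫ s in (0 : ℝ)..t, S (t - s) (f s)

end C0Semigroup

/-- The `T`-periodic discrete observation `(H_T f)(t) = f([t / T] T)` for `t ≥ 0`. -/
noncomputable def sampleHold {Y : Type*} (T : ℝ) (f : ℝ → Y) (t : ℝ) : Y :=
  f ((⌊t / T⌋₊ : ℝ) * T)

/-- `y` is the solution on `[0, ∞)` of the sampled closed loop system
`y'(t) = A y(t) + B F (H_T y)(t)`, `y 0 = y₀`, where `A` is the generator of `S`. -/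
def IsSampledClosedLoopSolution {𝕜 Y U : Type*} [RCLike 𝕜]
    [NormedAddCommGroup Y] [NormedSpace 𝕜 Y] [NormedSpace ℝ Y]
    [NormedAddCommGroup U] [NormedSpace 𝕜 U]
    (S : C0Semigroup 𝕜 Y) (B : U →L[𝕜] Y) (F : Y →L[𝕜] U) (T : ℝ) (y₀ : Y) (y : ℝ → Y) : Prop :=
  S.IsMildSolution (fun t => B (F (sampleHold T y t))) y₀ y

/-- The system `y' = A y + B u`, where `A` is the generator of `S`, is `(DC)_T`-stabilizable:
for some constant feedback law `F ∈ L(Y; U)`, all solutions of the sampled closed loop system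
decay exponentially, uniformly with respect to the initial state. (For `T > 0`, every `F` and
every `y₀`, a solution exists and is unique on `[0, ∞)`.) -/
def IsDCStabilizable {𝕜 Y U : Type*} [RCLike 𝕜]
    [NormedAddCommGroup Y] [NormedSpace 𝕜 Y] [NormedSpace ℝ Y]
    [NormedAddCommGroup U] [NormedSpace 𝕜 U]
    (S : C0Semigroup 𝕜 Y) (B : U →L[𝕜] Y) (T : ℝ) : Prop :=
  ∃ F : Y →L[𝕜] U, ∃ M ω : ℝ, 0 < ω ∧
    ∀ (y₀ : Y) (y : ℝ → Y), IsSampledClosedLoopSolution S B F T y₀ y →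
      ∀ t : ℝ, 0 ≤ t → ‖y t‖ ≤ M * Real.exp (-(ω * t)) * ‖y₀‖

/-! At sampling times the closed loop is `y (k + 1) = Q y k`, where `Q = S(T) + (∫₀ᵀ S) B F`, so
stabilizability at period `T` amounts to `‖Q ^ n‖ → 0` for some `F`. Since `S` is only strongly
continuous, `Q` need not vary norm-continuously with `T`, and `F` cannot simply be kept at a nearby
period `T'`.

Instead, keep the control values `F (Q ^ j x)`, `j < n`, switch them on the grid of `T'`, and append
one step of zero control. Compared at the same time `(n + 1) T'`, the two responses have the same
term `S((n + 1) T') x` and differ only through their switching times; `t ↦ ∫₀ᵗ S` is Lipschitz in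
operator norm, so the difference is `O(|T' - T|) ‖x‖`. The response on the old grid is `S(h) Q ^ n
x` with `h` bounded, hence small. This is `exists_openLoop_contraction`.

An open-loop contraction, repeated in blocks, gives a square summable trajectory from every state.
The trajectories of minimal norm come from a bounded feedback, which the discrete Datko theorem
shows to be power stable (`exists_feedback_of_openLoop_contraction`). The new feedback may depend on
`T'`. -/

/-! ### Geometric decay and power stability -/

theorem exists_half_pow_div_le (m : ℕ) (hm : 0 < m) :
    ∃ ρ : ℝ, 0 < ρ ∧ ρ < 1 ∧ ∀ k : ℕ, (1 / 2 : ℝ) ^ (k / m) ≤ 2 * ρ ^ k := by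
  have hm' : (m : ℝ) ≠ 0 := by positivity
  refine ⟨(1 / 2 : ℝ) ^ (1 / (m : ℝ)), by positivity,
    Real.rpow_lt_one (by norm_num) (by norm_num) (by positivity), fun k => ?_⟩
  set ρ : ℝ := (1 / 2 : ℝ) ^ (1 / (m : ℝ)) with hρ
  have hρm : ρ ^ m = 1 / 2 := by
    rw [hρ, ← Real.rpow_natCast, ← Real.rpow_mul (by norm_num)]
    field_simp
    simp
  have hρ0 : 0 < ρ := by positivity
  have hρ1 : ρ ≤ 1 := Real.rpow_le_one (by norm_num) (by norm_num) (by positivity)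
  -- An incomplete block costs at most `ρ ^ m = 1 / 2`, whence the factor 2.
  have h1 : (1 / 2 : ℝ) ≤ ρ ^ (k % m) := by
    rw [← hρm]
    exact pow_le_pow_of_le_one hρ0.le hρ1 (Nat.mod_lt k hm).le
  have h2 : ρ ^ k = (1 / 2) ^ (k / m) * ρ ^ (k % m) := by
    conv_lhs => rw [← Nat.div_add_mod k m]
    rw [pow_add, pow_mul, hρm]
  rw [h2]
  nlinarith [pow_pos (show (0 : ℝ) < 1 / 2 by norm_num) (k / m)]

/-- The `r`-step transition operator of `y (k + 1) = A y k + B u k` under the open loop control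
`u k = G k y₀`. -/
noncomputable def openLoop {𝕜 Y U : Type*} [RCLike 𝕜] [NormedAddCommGroup Y] [NormedSpace 𝕜 Y]
    [NormedAddCommGroup U] [NormedSpace 𝕜 U] (A : Y →L[𝕜] Y) (B : U →L[𝕜] Y)
    (G : ℕ → Y →L[𝕜] U) : ℕ → Y →L[𝕜] Y
  | 0 => ContinuousLinearMap.id 𝕜 Y
  | r + 1 => A.comp (openLoop A B G r) + B.comp (G r)

section NormedSpace

variable {𝕜 Y U : Type*} [RCLike 𝕜] [NormedAddCommGroup Y] [NormedSpace 𝕜 Y]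
    [NormedAddCommGroup U] [NormedSpace 𝕜 U]

theorem norm_pow_le_of_norm_le_half {L : Y →L[𝕜] Y} (hL : ‖L‖ ≤ 1 / 2) (q : ℕ) (y : Y) :
    ‖(L ^ q) y‖ ≤ (1 / 2) ^ q * ‖y‖ := by
  induction q with
  | zero => simp
  | succ q ih =>
    rw [pow_succ', mul_apply_eq_comp]
    calc ‖L ((L ^ q) y)‖ ≤ 1 / 2 * ((1 / 2) ^ q * ‖y‖) := L.le_of_opNorm_le_of_le hL ih
      _ = _ := by ring

theorem exists_norm_le_of_finite_family {E F : Type*} [SeminormedAddCommGroup E]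
    [NormedSpace 𝕜 E] [SeminormedAddCommGroup F] [NormedSpace 𝕜 F] (M : ℕ → E →L[𝕜] F) (m : ℕ) :
    ∃ C : ℝ, 0 ≤ C ∧ ∀ r < m, ‖M r‖ ≤ C :=
  ⟨∑ r ∈ Finset.range m, ‖M r‖, by positivity, fun r hr =>
    Finset.single_le_sum (f := fun r => ‖M r‖) (fun _ _ => norm_nonneg _) (Finset.mem_range.2 hr)⟩

theorem exists_periodic_geometric_bound {E F : Type*} [SeminormedAddCommGroup F]
    [NormedSpace 𝕜 F] [NormedAddCommGroup E] [NormedSpace 𝕜 E] (m : ℕ) (hm : 0 < m)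
    {L : E →L[𝕜] E} (hL : ‖L‖ ≤ 1 / 2) (M : ℕ → E →L[𝕜] F) :
    ∃ C ρ : ℝ, 0 ≤ C ∧ 0 < ρ ∧ ρ < 1 ∧
      ∀ (k : ℕ) (y : E), ‖M (k % m) ((L ^ (k / m)) y)‖ ≤ C * ρ ^ k * ‖y‖ := by
  obtain ⟨ρ, h0, h1, hρ⟩ := exists_half_pow_div_le m hm
  obtain ⟨C, hC0, hC⟩ := exists_norm_le_of_finite_family M m
  refine ⟨C * 2, ρ, by positivity, h0, h1, fun k y => ?_⟩
  calc ‖M (k % m) ((L ^ (k / m)) y)‖ ≤ C * ((1 / 2) ^ (k / m) * ‖y‖) :=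
        (M _).le_of_opNorm_le_of_le (hC _ (Nat.mod_lt k hm)) (norm_pow_le_of_norm_le_half hL _ y)
    _ ≤ C * (2 * ρ ^ k * ‖y‖) := by gcongr; exact hρ k
    _ = _ := by ring

theorem exists_norm_pow_le_geometric {Q : Y →L[𝕜] Y}
    (hQ : Filter.Tendsto (fun n => ‖Q ^ n‖) Filter.atTop (nhds 0)) :
    ∃ C ρ : ℝ, 0 ≤ C ∧ 0 < ρ ∧ ρ < 1 ∧ ∀ (k : ℕ) (y : Y), ‖(Q ^ k) y‖ ≤ C * ρ ^ k * ‖y‖ := by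
  obtain ⟨m, hm, hm0⟩ := ((hQ.eventually (ge_mem_nhds (show (0 : ℝ) < 1 / 2 by norm_num))).and
    (Filter.eventually_gt_atTop 0)).exists
  obtain ⟨C, ρ, hC, h0, h1, h⟩ := exists_periodic_geometric_bound m hm0 hm (fun r => Q ^ r)
  refine ⟨C, ρ, hC, h0, h1, fun k y => ?_⟩
  have := h k y
  rwa [← mul_apply_eq_comp, ← pow_mul, ← pow_add, Nat.mod_add_div] at this

/-- Discrete Datko theorem. -/
theorem tendsto_norm_pow_of_sum_sq_le {Q : Y →L[𝕜] Y} {C : ℝ} (hC0 : 0 ≤ C)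
    (hC : ∀ (y : Y) (n : ℕ), ∑ k ∈ Finset.range n, ‖(Q ^ k) y‖ ^ 2 ≤ C * ‖y‖ ^ 2) :
    Filter.Tendsto (fun n => ‖Q ^ n‖) Filter.atTop (nhds 0) := by
  have hb : ∀ (n : ℕ) (y : Y), ‖(Q ^ n) y‖ ^ 2 ≤ C * ‖y‖ ^ 2 := fun n y =>
    (Finset.single_le_sum (f := fun k => ‖(Q ^ k) y‖ ^ 2) (fun _ _ => by positivity)
      (Finset.self_mem_range_succ n)).trans (hC y (n + 1))
  -- Each of the `n` factorizations `Q ^ n = Q ^ (n - k) Q ^ k` bounds the same quantity; summing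
  -- them gives the uniform rate `1 / √n`.
  have h2 : ∀ (n : ℕ) (y : Y), n * ‖(Q ^ n) y‖ ^ 2 ≤ C ^ 2 * ‖y‖ ^ 2 := fun n y => by
    calc n * ‖(Q ^ n) y‖ ^ 2 = ∑ k ∈ Finset.range n, ‖(Q ^ n) y‖ ^ 2 := by simp
      _ ≤ ∑ k ∈ Finset.range n, C * ‖(Q ^ k) y‖ ^ 2 := by
        refine Finset.sum_le_sum fun k hk => ?_
        have : (Q ^ n) y = (Q ^ (n - k)) ((Q ^ k) y) := by
          rw [← mul_apply_eq_comp, ← pow_add,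
            Nat.sub_add_cancel (Finset.mem_range.1 hk).le]
        rw [this]
        exact hb _ _
      _ ≤ C * (C * ‖y‖ ^ 2) := by
        rw [← Finset.mul_sum]
        exact mul_le_mul_of_nonneg_left (hC y n) hC0
      _ = _ := by ring
  have h3 : ∀ n : ℕ, ‖Q ^ (n + 1)‖ ≤ C / Real.sqrt ((n + 1 : ℕ) : ℝ) := fun n => by
    have hn : (0 : ℝ) < ((n + 1 : ℕ) : ℝ) := by positivity
    refine ContinuousLinearMap.opNorm_le_bound _ (by positivity) fun y => ?_
    refine le_of_sq_le_sq ?_ (by positivity)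
    rw [mul_pow, div_pow, Real.sq_sqrt hn.le, div_mul_eq_mul_div, le_div_iff₀ hn, mul_comm]
    exact h2 (n + 1) y
  rw [← Filter.tendsto_add_atTop_iff_nat 1]
  refine squeeze_zero (fun _ => norm_nonneg _) h3 ?_
  have h4 : Filter.Tendsto (fun n : ℕ => Real.sqrt ((n + 1 : ℕ) : ℝ)) Filter.atTop Filter.atTop :=
    Real.tendsto_sqrt_atTop.comp
      (tendsto_natCast_atTop_atTop.comp (Filter.tendsto_add_atTop_nat 1))
  exact h4.const_div_atTop C

end NormedSpace

/-! ### Discrete linear-quadratic control: from open loop to feedback -/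

section LinearQuadratic

variable {𝕜 Y U : Type*} [RCLike 𝕜] [NormedAddCommGroup Y] [InnerProductSpace 𝕜 Y]
    [NormedAddCommGroup U] [InnerProductSpace 𝕜 U]

/-- The square summable state-control sequences. -/
noncomputable abbrev StateControl (Y U : Type*) [NormedAddCommGroup Y] [NormedAddCommGroup U] :=
  lp (fun _ : ℕ => WithLp 2 (Y × U)) 2

theorem memlp_two_iff {E : Type*} [NormedAddCommGroup E] {f : ℕ → E} :
    Memℓp (E := fun _ => E) f 2 ↔ Summable fun k => ‖f k‖ ^ 2 := by
  rw [memℓp_gen_iff (by simp)]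
  simp

/-- Evaluation at time `k`. -/
noncomputable def evalAt (𝕜 Y U : Type*) [RCLike 𝕜] [NormedAddCommGroup Y] [InnerProductSpace 𝕜 Y]
    [NormedAddCommGroup U] [InnerProductSpace 𝕜 U] (k : ℕ) :
    StateControl Y U →L[𝕜] WithLp 2 (Y × U) :=
  LinearMap.mkContinuous
    { toFun := fun z => z k
      map_add' := fun _ _ => rfl
      map_smul' := fun _ _ => rfl } 1 fun z => by
    rw [one_mul]
    exact lp.norm_apply_le_norm (by simp) z k

/-- The state at time `k`. -/
noncomputable def stateAt (𝕜 Y U : Type*) [RCLike 𝕜] [NormedAddCommGroup Y] [InnerProductSpace 𝕜 Y]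
    [NormedAddCommGroup U] [InnerProductSpace 𝕜 U] (k : ℕ) : StateControl Y U →L[𝕜] Y :=
  (WithLp.fstL 2 𝕜 Y U).comp (evalAt 𝕜 Y U k)

/-- The control at time `k`. -/
noncomputable def inputAt (𝕜 Y U : Type*) [RCLike 𝕜] [NormedAddCommGroup Y]
    [InnerProductSpace 𝕜 Y] [NormedAddCommGroup U] [InnerProductSpace 𝕜 U] (k : ℕ) :
    StateControl Y U →L[𝕜] U :=
  (WithLp.sndL 2 𝕜 Y U).comp (evalAt 𝕜 Y U k)

@[simp] theorem stateAt_apply (k : ℕ) (z : StateControl Y U) : stateAt 𝕜 Y U k z = (z k).fst := rfl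

@[simp] theorem inputAt_apply (k : ℕ) (z : StateControl Y U) :
    inputAt 𝕜 Y U k z = (z k).snd := rfl

/-- The square summable trajectories of `y (k + 1) = A y k + B u k`. -/
noncomputable def trajectories (A : Y →L[𝕜] Y) (B : U →L[𝕜] Y) :
    Submodule 𝕜 (StateControl Y U) :=
  ⨅ k : ℕ, (stateAt 𝕜 Y U (k + 1) -
    (A.comp (stateAt 𝕜 Y U k) + B.comp (inputAt 𝕜 Y U k))).ker

theorem mem_trajectories {A : Y →L[𝕜] Y} {B : U →L[𝕜] Y} {z : StateControl Y U} :
    z ∈ trajectories A B ↔ ∀ k, (z (k + 1)).fst = A (z k).fst + B (z k).snd := by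
  simp [trajectories, sub_eq_zero]

theorem isClosed_trajectories (A : Y →L[𝕜] Y) (B : U →L[𝕜] Y) :
    IsClosed (trajectories A B : Set (StateControl Y U)) := by
  rw [trajectories, Submodule.coe_iInf]
  exact isClosed_iInter fun k => ContinuousLinearMap.isClosed_ker _

theorem exists_shift (z : StateControl Y U) : ∃ w : StateControl Y U, ∀ k, w k = z (k + 1) :=
  ⟨⟨fun k => z (k + 1), memlp_two_iff.2
    ((summable_nat_add_iff (f := fun k => ‖z k‖ ^ 2) 1).2 (memlp_two_iff.1 (lp.memℓp z)))⟩,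
    fun _ => rfl⟩

theorem exists_pad (z : StateControl Y U) :
    ∃ w : StateControl Y U, w 0 = 0 ∧ ∀ k, w (k + 1) = z k := by
  let f : ℕ → WithLp 2 (Y × U) := fun
    | 0 => 0
    | k + 1 => z k
  have hf : Memℓp (E := fun _ => WithLp 2 (Y × U)) f 2 := memlp_two_iff.2
    ((summable_nat_add_iff (f := fun k => ‖f k‖ ^ 2) 1).1 (memlp_two_iff.1 (lp.memℓp z)))
  exact ⟨⟨f, hf⟩, rfl, fun _ => rfl⟩

/-- Padding by zero is the adjoint of the left shift. This transfers orthogonality, hence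
minimality, to tails of trajectories. -/
theorem inner_pad_eq_inner_shift {p d z w : StateControl Y U} (hp0 : p 0 = 0)
    (hp : ∀ k, p (k + 1) = d k) (hw : ∀ k, w k = z (k + 1)) :
    inner 𝕜 p z = inner 𝕜 d w := by
  have h1 : HasSum (fun k => inner 𝕜 (p k) (z k)) (inner 𝕜 p z) := lp.hasSum_inner p z
  have h2 : HasSum (fun k => inner 𝕜 (d k) (w k)) (inner 𝕜 d w) := lp.hasSum_inner d w
  have h3 := h1.summable.tsum_eq_zero_add
  rw [h1.tsum_eq, hp0, inner_zero_left, zero_add] at h3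
  rw [h3, ← h2.tsum_eq]
  simp only [hp, hw]

theorem sum_norm_sq_state_le (z : StateControl Y U) (n : ℕ) :
    ∑ k ∈ Finset.range n, ‖(z k).fst‖ ^ 2 ≤ ‖z‖ ^ 2 := by
  have h := lp.sum_rpow_le_norm_rpow (p := 2) (by simp) z (Finset.range n)
  simp only [ENNReal.toReal_ofNat, Real.rpow_ofNat] at h
  refine (Finset.sum_le_sum fun k _ => ?_).trans h
  rw [WithLp.prod_norm_sq_eq_of_L2]
  nlinarith [sq_nonneg ‖(z k).snd‖]

variable [CompleteSpace Y] [CompleteSpace U]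

/-- If every state is the start of a square summable trajectory, then the trajectories of minimal
norm are generated by a static feedback. -/
theorem exists_feedback_of_trajectories (A : Y →L[𝕜] Y) (B : U →L[𝕜] Y)
    (h : ∀ y : Y, ∃ z ∈ trajectories A B, (z 0).fst = y) :
    ∃ F : Y →L[𝕜] U, Filter.Tendsto (fun n => ‖(A + B.comp F) ^ n‖) Filter.atTop (nhds 0) := by
  set W := trajectories A B with hW
  set W₀ : Submodule 𝕜 (StateControl Y U) := W ⊓ (stateAt 𝕜 Y U 0).ker with hW₀
  have hW₀c : IsClosed (W₀ : Set (StateControl Y U)) :=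
    (isClosed_trajectories A B).inter (ContinuousLinearMap.isClosed_ker _)
  have : CompleteSpace W₀ := hW₀c.completeSpace_coe
  -- Trajectories with a given initial state form a coset of `W₀`; the one of minimal norm is the
  -- one orthogonal to `W₀`, so it depends linearly on that state.
  set V : Submodule 𝕜 (StateControl Y U) := W ⊓ W₀ᗮ with hV
  have hVc : IsClosed (V : Set (StateControl Y U)) :=
    (isClosed_trajectories A B).inter W₀.isClosed_orthogonal
  have : CompleteSpace V := hVc.completeSpace_coe
  set e : V →L[𝕜] Y := (stateAt 𝕜 Y U 0).comp V.subtypeL with he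
  have hker : e.ker = ⊥ := by
    rw [eq_bot_iff]
    rintro ⟨z, hzW, hzo⟩ hz
    have hz0 : z ∈ W₀ := ⟨hzW, hz⟩
    have : z = 0 := by
      have := W₀.inf_orthogonal_eq_bot.le ⟨hz0, hzo⟩
      simpa using this
    exact Subtype.ext this
  have hrange : e.range = ⊤ := by
    rw [eq_top_iff]
    rintro y -
    obtain ⟨z, hz, hzy⟩ := h y
    have hp : W₀.starProjection z ∈ W₀ := W₀.starProjection_apply_mem z
    refine ⟨⟨z - W₀.starProjection z, W.sub_mem hz hp.1, W₀.sub_starProjection_mem_orthogonal z⟩, ?_⟩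
    have h0 : stateAt 𝕜 Y U 0 (W₀.starProjection z) = 0 := hp.2
    change stateAt 𝕜 Y U 0 (z - W₀.starProjection z) = y
    rw [map_sub, h0, sub_zero]
    exact hzy
  -- The open mapping theorem makes the minimal trajectory a bounded function of the initial state.
  set E := ContinuousLinearEquiv.ofBijective e hker hrange with hE
  set R : Y →L[𝕜] StateControl Y U := V.subtypeL.comp (E.symm : Y →L[𝕜] V) with hR
  have hRW : ∀ y, R y ∈ W := fun y => (E.symm y).2.1
  have hRo : ∀ y, R y ∈ W₀ᗮ := fun y => (E.symm y).2.2
  have hR0 : ∀ y, ((R y) 0).fst = y := fun y =>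
    ContinuousLinearEquiv.ofBijective_apply_symm_apply e hker hrange y
  have hRuniq : ∀ z ∈ W, z ∈ W₀ᗮ → R (z 0).fst = z := fun z hz hzo => by
    have h1 : R (z 0).fst - z ∈ W₀ := by
      refine ⟨W.sub_mem (hRW _) hz, ?_⟩
      change (R (z 0).fst 0).fst - (z 0).fst = 0
      rw [hR0, sub_self]
    have h2 : R (z 0).fst - z ∈ W₀ᗮ := W₀ᗮ.sub_mem (hRo _) hzo
    have := W₀.inf_orthogonal_eq_bot.le ⟨h1, h2⟩
    exact sub_eq_zero.1 (by simpa using this)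
  refine ⟨(inputAt 𝕜 Y U 0).comp R, ?_⟩
  set F : Y →L[𝕜] U := (inputAt 𝕜 Y U 0).comp R with hF
  have hFy : ∀ y, F y = ((R y) 0).snd := fun _ => rfl
  clear_value F R
  -- Dynamic programming: the tail of a minimal trajectory is the minimal one from its own initial
  -- state, because padding an element of `W₀` stays in `W₀`.
  have hstep : ∀ (y : Y) (k : ℕ), (R y) (k + 1) = (R ((A + B.comp F) y)) k := fun y k => by
    obtain ⟨w, hw⟩ := exists_shift (R y)
    have hwW : w ∈ W := mem_trajectories.2 fun k => by
      rw [hw, hw]; exact mem_trajectories.1 (hRW y) (k + 1)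
    have hwo : w ∈ W₀ᗮ := by
      rw [Submodule.mem_orthogonal]
      intro d hd
      obtain ⟨p, hp0, hp⟩ := exists_pad d
      have hd0 : (d 0).fst = 0 := hd.2
      have hpW : p ∈ W₀ := by
        refine ⟨mem_trajectories.2 fun k => ?_, ?_⟩
        · cases k with
          | zero => rw [hp, hp0, hd0]; simp
          | succ k => rw [hp, hp]; exact mem_trajectories.1 hd.1 k
        · change (p 0).fst = 0
          rw [hp0]; rfl
      have hin := (Submodule.mem_orthogonal _ _).1 (hRo y) p hpW
      rw [← hin]
      exact (inner_pad_eq_inner_shift hp0 hp hw).symm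
    have hw0 : (w 0).fst = (A + B.comp F) y := by
      rw [hw, mem_trajectories.1 (hRW y) 0, hR0]
      change _ = A y + B (F y)
      rw [hFy]
    rw [← hw, ← hw0, hRuniq w hwW hwo]
  have hpow : ∀ (k : ℕ) (y : Y), ((R y) k).fst = ((A + B.comp F) ^ k) y := fun k => by
    induction k with
    | zero => intro y; simpa using hR0 y
    | succ k ih => intro y; rw [hstep, ih, pow_succ, mul_apply_eq_comp]
  refine tendsto_norm_pow_of_sum_sq_le (C := ‖R‖ ^ 2) (by positivity) fun y n => ?_
  simp only [← hpow]
  refine (sum_norm_sq_state_le (R y) n).trans ?_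
  rw [← mul_pow]
  gcongr
  exact R.le_opNorm y

/-- A linear open loop control that contracts the state in finitely many steps can be replaced by
a stabilizing static feedback. -/
theorem exists_feedback_of_openLoop_contraction (A : Y →L[𝕜] Y) (B : U →L[𝕜] Y)
    (G : ℕ → Y →L[𝕜] U) (m : ℕ) (hm : 0 < m) (hG : ‖openLoop A B G m‖ ≤ 1 / 2) :
    ∃ F : Y →L[𝕜] U, Filter.Tendsto (fun n => ‖(A + B.comp F) ^ n‖) Filter.atTop (nhds 0) := by
  refine exists_feedback_of_trajectories A B fun y => ?_
  set L := openLoop A B G m with hL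
  obtain ⟨C, ρ, hC, hρ0, hρ1, h1⟩ := exists_periodic_geometric_bound m hm hG (openLoop A B G)
  obtain ⟨C', ρ', hC', hρ0', hρ1', h2⟩ := exists_periodic_geometric_bound m hm hG G
  have hsum : ∀ {c r : ℝ}, 0 < r → r < 1 → Summable fun k : ℕ => (c * r ^ k * ‖y‖) ^ 2 := by
    intro c r hr0 hr1
    have : Summable fun k : ℕ => (c * ‖y‖) ^ 2 * (r ^ 2) ^ k :=
      (summable_geometric_of_lt_one (by positivity) (by nlinarith)).mul_left _
    refine this.congr fun k => ?_
    rw [← pow_mul, mul_comm 2 k, pow_mul]; ring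
  have hmem : Memℓp (E := fun _ => WithLp 2 (Y × U)) (fun k : ℕ => WithLp.toLp 2
      (openLoop A B G (k % m) ((L ^ (k / m)) y), G (k % m) ((L ^ (k / m)) y))) 2 := by
    refine memlp_two_iff.2 (Summable.of_nonneg_of_le (fun _ => by positivity) (fun k => ?_)
      ((hsum (c := C) hρ0 hρ1).add (hsum (c := C') hρ0' hρ1')))
    rw [WithLp.prod_norm_sq_eq_of_L2]
    exact add_le_add (pow_le_pow_left₀ (norm_nonneg _) (h1 k y) 2)
      (pow_le_pow_left₀ (norm_nonneg _) (h2 k y) 2)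
  refine ⟨⟨_, hmem⟩, mem_trajectories.2 fun k => ?_, ?_⟩
  · change openLoop A B G ((k + 1) % m) ((L ^ ((k + 1) / m)) y) =
      A (openLoop A B G (k % m) ((L ^ (k / m)) y)) + B (G (k % m) ((L ^ (k / m)) y))
    have hr : A (openLoop A B G (k % m) ((L ^ (k / m)) y)) + B (G (k % m) ((L ^ (k / m)) y)) =
      openLoop A B G (k % m + 1) ((L ^ (k / m)) y) := rfl
    rw [hr]
    have hlt := Nat.mod_lt k hm
    -- At the end of a block the state is `L` applied to the block's initial state, which starts the
    -- next block.
    by_cases hk : k % m + 1 = m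
    · have hk0 : k + 1 = m * (k / m + 1) := by
        rw [mul_add, mul_one]
        have := Nat.div_add_mod k m
        omega
      rw [hk, hk0, Nat.mul_mod_right, Nat.mul_div_cancel_left _ hm, pow_succ']
      rfl
    · have hk0 : k + 1 = m * (k / m) + (k % m + 1) := by
        have := Nat.div_add_mod k m
        omega
      have hlt' : k % m + 1 < m := by omega
      conv_lhs => rw [hk0]
      rw [Nat.mul_add_mod, Nat.mod_eq_of_lt hlt', Nat.mul_add_div hm, Nat.div_eq_of_lt hlt',
        add_zero]
  · change openLoop A B G (0 % m) ((L ^ (0 / m)) y) = y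
    simp [openLoop]

end LinearQuadratic

/-! ### Piecewise constant inputs and the sampled closed loop -/

namespace C0Semigroup

open MeasureTheory

variable {𝕜 Y U : Type*} [RCLike 𝕜] [NormedAddCommGroup Y] [NormedSpace 𝕜 Y]
  (S : C0Semigroup 𝕜 Y)

theorem zero_apply (x : Y) : S 0 x = x := by
  rw [S.map_zero']; rfl

theorem add_apply {s t : ℝ} (hs : 0 ≤ s) (ht : 0 ≤ t) (x : Y) : S (s + t) x = S s (S t x) := by
  rw [S.map_add' s t hs ht]; rfl

theorem continuous_orbit_max (x : Y) : Continuous fun t : ℝ => S (max t 0) x :=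
  (S.continuousOn_orbit' x).comp_continuous (by fun_prop) fun _ => Set.mem_Ici.2 (le_max_right _ _)

theorem intervalIntegrable_orbit_max (x : Y) (a b : ℝ) :
    IntervalIntegrable (fun t : ℝ => S (max t 0) x) volume a b :=
  (S.continuous_orbit_max x).intervalIntegrable a b

theorem exists_norm_le [CompleteSpace Y] (R : ℝ) : ∃ K : ℝ, 0 ≤ K ∧ ∀ t, 0 ≤ t → t ≤ R → ‖S t‖ ≤ K := by
  obtain ⟨K, hK⟩ := banach_steinhaus (g := fun t : Set.Icc (0 : ℝ) R => S t) fun x => by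
    obtain ⟨C, hC⟩ := isCompact_Icc.exists_bound_of_continuousOn
      ((S.continuousOn_orbit' x).mono (Set.Icc_subset_Ici_self : Set.Icc 0 R ⊆ _))
    exact ⟨C, fun t => hC t t.2⟩
  exact ⟨max K 0, le_max_right _ _, fun t h0 h1 => (hK ⟨t, h0, h1⟩).trans (le_max_left _ _)⟩

variable [NormedSpace ℝ Y]

theorem norm_integral_orbit_le {R K : ℝ} (hK : ∀ t, 0 ≤ t → t ≤ R → ‖S t‖ ≤ K) {a b : ℝ}
    (haR : max a 0 ≤ R) (hbR : max b 0 ≤ R) (x : Y) :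
    ‖∫ s in max a 0..max b 0, S (max s 0) x‖ ≤ K * ‖x‖ * |b - a| := by
  have hR : 0 ≤ R := (le_max_right _ _).trans haR
  have hK0 : 0 ≤ K := (norm_nonneg _).trans (hK 0 le_rfl hR)
  refine (intervalIntegral.norm_integral_le_of_norm_le_const fun s hs => ?_).trans
    (mul_le_mul_of_nonneg_left (abs_max_sub_max_le_abs b a 0) (by positivity))
  refine (S (max s 0)).le_of_opNorm_le (hK _ (le_max_right _ _) (max_le ?_ hR)) x
  exact hs.2.trans (max_le haR hbR)

variable [CompleteSpace Y]

/-- The operator `x ↦ ∫ s in 0..t, S s x`, and zero for `t ≤ 0`. -/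
noncomputable def integralOp (t : ℝ) : Y →L[𝕜] Y :=
  LinearMap.mkContinuousOfExistsBound
    { toFun := fun x => ∫ s in 0..max t 0, S (max s 0) x
      map_add' := fun x y => by
        simp only [map_add]
        exact intervalIntegral.integral_add (S.intervalIntegrable_orbit_max x _ _)
          (S.intervalIntegrable_orbit_max y _ _)
      map_smul' := fun c x => by
        simp only [map_smul, RingHom.id_apply]
        exact intervalIntegral.integral_smul c _ } <| by
    obtain ⟨K, hK0, hK⟩ := S.exists_norm_le (max t 0)
    refine ⟨K * |t|, fun x => ?_⟩
    have h := S.norm_integral_orbit_le hK (a := 0) (b := t) (by simp) le_rfl x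
    rw [max_self, sub_zero] at h
    exact h.trans_eq (by ring)

theorem integralOp_apply (t : ℝ) (x : Y) :
    S.integralOp t x = ∫ s in 0..max t 0, S (max s 0) x := rfl

theorem integralOp_of_nonpos {t : ℝ} (ht : t ≤ 0) : S.integralOp t = 0 := by
  ext x
  rw [integralOp_apply, max_eq_right ht, intervalIntegral.integral_same]
  rfl

theorem integralOp_sub_apply (a b : ℝ) (x : Y) :
    S.integralOp b x - S.integralOp a x = ∫ s in max a 0..max b 0, S (max s 0) x := by
  rw [integralOp_apply, integralOp_apply]
  exact intervalIntegral.integral_interval_sub_left (S.intervalIntegrable_orbit_max x _ _)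
    (S.intervalIntegrable_orbit_max x _ _)

/-- The bound is uniform on the unit ball: integration turns strong continuity into operator-norm
Lipschitz continuity, which drives the perturbation argument. -/
theorem norm_integralOp_sub_apply_le {R K : ℝ} (hR : 0 ≤ R)
    (hK : ∀ t, 0 ≤ t → t ≤ R → ‖S t‖ ≤ K) {a b : ℝ} (haR : a ≤ R) (hbR : b ≤ R) (x : Y) :
    ‖S.integralOp b x - S.integralOp a x‖ ≤ K * ‖x‖ * |b - a| := by
  rw [integralOp_sub_apply]
  exact S.norm_integral_orbit_le hK (max_le haR hR) (max_le hbR hR) x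

theorem continuous_integralOp_apply (x : Y) : Continuous fun t => S.integralOp t x := by
  simp only [integralOp_apply]
  exact (intervalIntegral.continuous_primitive (S.intervalIntegrable_orbit_max x) 0).comp
    (g := fun t => ∫ s in 0..t, S (max s 0) x) (by fun_prop)

theorem apply_integralOp_sub {t a b : ℝ} (ht : 0 ≤ t) (ha : 0 ≤ a) (hb : 0 ≤ b) (x : Y) :
    S t (S.integralOp b x - S.integralOp a x) =
      S.integralOp (b + t) x - S.integralOp (a + t) x := by
  rw [integralOp_sub_apply, integralOp_sub_apply, max_eq_left ha, max_eq_left hb,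
    max_eq_left (add_nonneg ha ht), max_eq_left (add_nonneg hb ht),
    ← intervalIntegral.integral_comp_add_right (fun s => S (max s 0) x) t,
    ← ContinuousLinearMap.intervalIntegral_comp_comm _ (S.intervalIntegrable_orbit_max x a b)]
  refine intervalIntegral.integral_congr fun s hs => ?_
  have hs0 : 0 ≤ s := (le_min ha hb).trans hs.1
  simp only [max_eq_left hs0, max_eq_left (add_nonneg hs0 ht)]
  rw [add_comm, S.add_apply ht hs0]

/-- The `min` discards input after time `t`, matching the vanishing of `integralOp` at negative
times; no case split on the position of `t` is needed later. -/
theorem integral_convolution_const (t a b : ℝ) (g : Y) :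
    ∫ s in min t a..min t b, S (max (t - s) 0) g =
      S.integralOp (t - a) g - S.integralOp (t - b) g := by
  rw [integralOp_sub_apply, intervalIntegral.integral_comp_sub_left (fun s => S (max s 0) g) t]
  congr 1 <;> rcases le_total t a with h | h <;> rcases le_total t b with h' | h' <;> simp [h, h']

theorem floor_div_eq {T s : ℝ} (hT : 0 < T) {k : ℕ} (h1 : k * T ≤ s) (h2 : s < (k + 1) * T) :
    ⌊s / T⌋₊ = k := by
  rw [Nat.floor_eq_iff (div_nonneg ((by positivity : (0 : ℝ) ≤ k * T).trans h1) hT.le)]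
  exact ⟨(le_div_iff₀ hT).2 h1, (div_lt_iff₀ hT).2 h2⟩

theorem integral_convolution_step {T : ℝ} (hT : 0 < T) (g : ℕ → Y) {N : ℕ} {t : ℝ} (ht0 : 0 ≤ t)
    (htN : t ≤ N * T) :
    ∫ s in 0..t, S (t - s) (g ⌊s / T⌋₊) = ∑ j ∈ Finset.range N,
      (S.integralOp (t - j * T) (g j) - S.integralOp (t - (j + 1) * T) (g j)) := by
  have hae : ∀ k : ℕ, ∀ᵐ s, s ∈ Set.uIoc (min t (k * T)) (min t ((k + 1 : ℕ) * T)) →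
      S (t - s) (g ⌊s / T⌋₊) = S (max (t - s) 0) (g k) := fun k => by
    -- The floor jumps at the right endpoint, a null set.
    have hne : ∀ᵐ s : ℝ, s ≠ (k + 1 : ℕ) * T := by
      simp [ae_iff]
    filter_upwards [hne] with s hs hmem
    have hle : min t (k * T) ≤ min t ((k + 1 : ℕ) * T) :=
      min_le_min_left _ (by gcongr; simp)
    rw [Set.uIoc_of_le hle] at hmem
    have h1 : s ≤ t := hmem.2.trans (min_le_left _ _)
    have h2 : s < (k + 1) * T := by
      have := lt_of_le_of_ne (hmem.2.trans (min_le_right _ _)) hs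
      simpa using this
    have h3 : k * T ≤ s := by
      rcases min_lt_iff.1 hmem.1 with h | h
      · exact absurd h1 h.not_ge
      · exact h.le
    rw [floor_div_eq hT h3 h2, max_eq_left (sub_nonneg.2 h1)]
  have hint : ∀ k < N, IntervalIntegrable (fun s => S (t - s) (g ⌊s / T⌋₊)) volume
      (min t (k * T)) (min t ((k + 1 : ℕ) * T)) := fun k _ => by
    have hc : Continuous fun s : ℝ => S (max (t - s) 0) (g k) :=
      (S.continuous_orbit_max (g k)).comp (continuous_const.sub continuous_id)
    refine (hc.intervalIntegrable _ _).congr_ae ?_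
    rw [Filter.EventuallyEq, ae_restrict_iff' measurableSet_uIoc]
    filter_upwards [hae k] with s hs hmem using (hs hmem).symm
  have hsum := intervalIntegral.sum_integral_adjacent_intervals
    (a := fun k : ℕ => min t (k * T)) hint
  simp only [Nat.cast_zero, zero_mul, min_eq_right ht0, min_eq_left htN] at hsum
  rw [← hsum]
  refine Finset.sum_congr rfl fun k _ => ?_
  rw [intervalIntegral.integral_congr_ae (hae k), S.integral_convolution_const]
  push_cast
  rfl

/-- The mild solution at time `t ≤ N * T` for the input `∑ j, 1_[j T, (j + 1) T) • v j`. -/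
noncomputable def stepResponse (T : ℝ) (v : ℕ → Y) (N : ℕ) (x : Y) (t : ℝ) : Y :=
  S t x + ∑ j ∈ Finset.range N,
    (S.integralOp (t - j * T) (v j) - S.integralOp (t - (j + 1) * T) (v j))

/-- After `r * T` no input remains, so the state evolves freely. -/
theorem apply_stepResponse {T τ : ℝ} (hT : 0 < T) (hτ : 0 ≤ τ) (v : ℕ → Y) (r : ℕ) (x : Y) :
    S τ (S.stepResponse T v r x (r * T)) = S.stepResponse T v r x (r * T + τ) := by
  rw [stepResponse, stepResponse, map_add, map_sum, add_comm (r * T) τ,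
    S.add_apply hτ (by positivity)]
  congr 1
  refine Finset.sum_congr rfl fun j hj => ?_
  have hj' : (j : ℝ) + 1 ≤ r := by exact_mod_cast Finset.mem_range.1 hj
  have h0 : 0 ≤ r * T - (j + 1) * T := sub_nonneg.2 (by gcongr)
  rw [S.apply_integralOp_sub hτ h0 (by linarith)]
  ring_nf

theorem stepResponse_succ {T τ : ℝ} (hτT : τ ≤ T) (v : ℕ → Y) (r : ℕ) (x : Y) :
    S.stepResponse T v (r + 1) x (r * T + τ) =
      S.stepResponse T v r x (r * T + τ) + S.integralOp τ (v r) := by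
  rw [stepResponse, stepResponse, Finset.sum_range_succ,
    S.integralOp_of_nonpos (t := r * T + τ - (r + 1) * T) (by linarith)]
  simp [add_assoc]

theorem stepResponse_eq_of_le {T t : ℝ} (hT : 0 < T) (v : ℕ → Y) {r r' : ℕ} (hr : r ≤ r') (x : Y)
    (ht : t ≤ r * T) : S.stepResponse T v r' x t = S.stepResponse T v r x t := by
  induction r', hr using Nat.le_induction with
  | base => rfl
  | succ n hn ih =>
    have h : t ≤ n * T := ht.trans (by gcongr)
    rw [← ih, stepResponse, stepResponse, Finset.sum_range_succ,
      S.integralOp_of_nonpos (t := t - n * T) (by linarith),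
      S.integralOp_of_nonpos (t := t - (n + 1) * T) (by linarith)]
    simp

theorem stepResponse_congr {T t : ℝ} {v w : ℕ → Y} {r : ℕ} (h : ∀ j < r, v j = w j) (x : Y) :
    S.stepResponse T v r x t = S.stepResponse T w r x t := by
  rw [stepResponse, stepResponse]
  congr 1
  exact Finset.sum_congr rfl fun j hj => by rw [h j (Finset.mem_range.1 hj)]

theorem continuousOn_stepResponse (T : ℝ) (v : ℕ → Y) (N : ℕ) (x : Y) :
    ContinuousOn (S.stepResponse T v N x) (Set.Ici 0) := by
  refine (S.continuousOn_orbit' x).add (Continuous.continuousOn ?_)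
  refine continuous_finsetSum _ fun j _ => ?_
  exact ((S.continuous_integralOp_apply (v j)).comp (continuous_id.sub continuous_const)).sub
    ((S.continuous_integralOp_apply (v j)).comp (continuous_id.sub continuous_const))

variable [NormedAddCommGroup U] [NormedSpace 𝕜 U] (B : U →L[𝕜] Y)

theorem openLoop_apply_eq_stepResponse {T : ℝ} (hT : 0 < T) (G : ℕ → Y →L[𝕜] U) (r : ℕ) (x : Y) :
    openLoop (S T) ((S.integralOp T).comp B) G r x =
      S.stepResponse T (fun j => B (G j x)) r x (r * T) := by
  induction r with
  | zero => simp [openLoop, stepResponse, S.zero_apply]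
  | succ r ih =>
    have h : ((r + 1 : ℕ) : ℝ) * T = r * T + T := by push_cast; ring
    rw [h, S.stepResponse_succ le_rfl, ← S.apply_stepResponse hT hT.le, ← ih]
    rfl

/-- The evolution of the closed loop system during one sampling interval. -/
noncomputable def sampledOp (F : Y →L[𝕜] U) (τ : ℝ) : Y →L[𝕜] Y :=
  S τ + ((S.integralOp τ).comp B).comp F

/-- Reading the feedback as an open-loop control lets formulas for `openLoop` apply to the closed
loop. -/
theorem openLoop_feedback (F : Y →L[𝕜] U) (T : ℝ) (r : ℕ) :
    openLoop (S T) ((S.integralOp T).comp B) (fun j => F.comp (S.sampledOp B F T ^ j)) r =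
      S.sampledOp B F T ^ r := by
  induction r with
  | zero => rfl
  | succ r ih => rw [openLoop, ih, pow_succ']; rfl

theorem pow_sampledOp_apply_eq_stepResponse {T : ℝ} (hT : 0 < T) (F : Y →L[𝕜] U) (r : ℕ) (x : Y) :
    (S.sampledOp B F T ^ r) x =
      S.stepResponse T (fun j => B (F ((S.sampledOp B F T ^ j) x))) r x (r * T) := by
  rw [← S.openLoop_feedback, S.openLoop_apply_eq_stepResponse B hT]
  rfl

theorem solution_eq_stepResponse {T : ℝ} (hT : 0 < T) {F : Y →L[𝕜] U} {x : Y} {y : ℝ → Y}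
    (hy : IsSampledClosedLoopSolution S B F T x y) {N : ℕ} {t : ℝ} (ht0 : 0 ≤ t)
    (htN : t ≤ N * T) : y t = S.stepResponse T (fun j => B (F (y (j * T)))) N x t := by
  rw [hy.2 t ht0, stepResponse, ← S.integral_convolution_step hT _ ht0 htN]
  rfl

theorem solution_eq_sampledOp {T τ : ℝ} (hT : 0 < T) (hτ : 0 ≤ τ) (hτT : τ ≤ T) {F : Y →L[𝕜] U}
    {x : Y} {y : ℝ → Y} (hy : IsSampledClosedLoopSolution S B F T x y) (k : ℕ) :
    y (k * T + τ) = S.sampledOp B F τ (y (k * T)) := by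
  have h1 := S.solution_eq_stepResponse B hT hy (N := k + 1) (t := k * T + τ) (by positivity)
    (by push_cast; linarith)
  rw [h1, S.stepResponse_succ hτT, ← S.apply_stepResponse hT hτ,
    ← S.solution_eq_stepResponse B hT hy (by positivity) le_rfl]
  rfl

theorem solution_eq_pow {T : ℝ} (hT : 0 < T) {F : Y →L[𝕜] U} {x : Y} {y : ℝ → Y}
    (hy : IsSampledClosedLoopSolution S B F T x y) (k : ℕ) :
    y (k * T) = (S.sampledOp B F T ^ k) x := by
  induction k with
  | zero =>
    rw [S.solution_eq_stepResponse B hT hy (N := 0) (by simp) le_rfl]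
    simp [stepResponse, S.zero_apply]
  | succ k ih =>
    have h : ((k + 1 : ℕ) : ℝ) * T = k * T + T := by push_cast; ring
    rw [h, S.solution_eq_sampledOp B hT hT.le le_rfl hy, ih, pow_succ']
    rfl

theorem exists_solution {T : ℝ} (hT : 0 < T) (F : Y →L[𝕜] U) (x : Y) :
    ∃ y : ℝ → Y, IsSampledClosedLoopSolution S B F T x y := by
  set v : ℕ → Y := fun j => B (F ((S.sampledOp B F T ^ j) x)) with hv
  -- By causality any number of steps covering `t` gives the same value, so near each point one
  -- fixed `stepResponse` represents `y`.
  set y : ℝ → Y := fun t => S.stepResponse T v (⌊t / T⌋₊ + 1) x t with hy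
  have hlt : ∀ t : ℝ, t < (⌊t / T⌋₊ + 1 : ℕ) * T := fun t => by
    rw [← div_lt_iff₀ hT]
    push_cast
    exact Nat.lt_floor_add_one _
  have hyN : ∀ (N : ℕ) (t : ℝ), t ≤ N * T → y t = S.stepResponse T v N x t := fun N t ht => by
    rcases le_total N (⌊t / T⌋₊ + 1) with h | h
    · exact S.stepResponse_eq_of_le hT v h x ht
    · exact (S.stepResponse_eq_of_le hT v h x (hlt t).le).symm
  have hyk : ∀ k : ℕ, y (k * T) = (S.sampledOp B F T ^ k) x := fun k => by
    rw [hyN k _ le_rfl, S.pow_sampledOp_apply_eq_stepResponse B hT]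
  refine ⟨y, fun t ht => ?_, fun t ht => ?_⟩
  · refine ((S.continuousOn_stepResponse T v (⌊t / T⌋₊ + 1) x) t ht).congr_of_eventuallyEq ?_
      (hyN _ t (hlt t).le)
    filter_upwards [mem_nhdsWithin_of_mem_nhds (Iio_mem_nhds (hlt t))] with s hs
    exact hyN _ s (le_of_lt hs)
  · rw [hyN _ t (hlt t).le, stepResponse, ← S.integral_convolution_step hT v ht (hlt t).le]
    simp only [sampleHold, hyk, hv]

end C0Semigroup

/-! ### Stabilizability as power stability, and perturbation of the period -/

namespace C0Semigroup

variable {𝕜 Y U : Type*} [RCLike 𝕜] [NormedAddCommGroup Y] [NormedSpace 𝕜 Y]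
  [CompleteSpace Y] [NormedSpace ℝ Y] [NormedAddCommGroup U] [NormedSpace 𝕜 U]
  (S : C0Semigroup 𝕜 Y) (B : U →L[𝕜] Y)

theorem exists_norm_sampledOp_le (F : Y →L[𝕜] U) {T : ℝ} (hT : 0 < T) :
    ∃ C : ℝ, 0 ≤ C ∧ ∀ τ, 0 ≤ τ → τ ≤ T → ∀ x, ‖S.sampledOp B F τ x‖ ≤ C * ‖x‖ := by
  obtain ⟨K, hK0, hK⟩ := S.exists_norm_le T
  refine ⟨K + K * ‖B.comp F‖ * T, by positivity, fun τ h0 h1 x => ?_⟩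
  have h2 := S.norm_integralOp_sub_apply_le hT.le hK hT.le h1 (B (F x))
  rw [S.integralOp_of_nonpos le_rfl, _root_.zero_apply, sub_zero, sub_zero, abs_of_nonneg h0] at h2
  calc ‖S.sampledOp B F τ x‖ ≤ ‖S τ x‖ + ‖S.integralOp τ (B (F x))‖ := norm_add_le _ _
    _ ≤ K * ‖x‖ + K * (‖B.comp F‖ * ‖x‖) * T := by
      refine add_le_add ((S τ).le_of_opNorm_le (hK τ h0 h1) x) (h2.trans ?_)
      gcongr
      exact (B.comp F).le_opNorm x
    _ = _ := by ring

theorem isDCStabilizable_of_tendsto {T : ℝ} (hT : 0 < T) (F : Y →L[𝕜] U)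
    (hF : Filter.Tendsto (fun n => ‖S.sampledOp B F T ^ n‖) Filter.atTop (nhds 0)) :
    IsDCStabilizable S B T := by
  obtain ⟨C, ρ, hC, hρ0, hρ1, hρ⟩ := exists_norm_pow_le_geometric hF
  obtain ⟨C', hC', h⟩ := S.exists_norm_sampledOp_le B F hT
  have hlog : Real.log ρ < 0 := Real.log_neg hρ0 hρ1
  refine ⟨F, C' * C * ρ⁻¹, -Real.log ρ / T, div_pos (by linarith) hT, fun x y hy t ht => ?_⟩
  set k := ⌊t / T⌋₊ with hk
  have h1 : k * T ≤ t := (le_div_iff₀ hT).1 (Nat.floor_le (by positivity))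
  have h2 : t < (k + 1) * T := (div_lt_iff₀ hT).1 (Nat.lt_floor_add_one _)
  have h3 := S.solution_eq_sampledOp B hT (sub_nonneg.2 h1) (by linarith : t - k * T ≤ T) hy k
  rw [add_sub_cancel, S.solution_eq_pow B hT hy] at h3
  -- The factor `ρ⁻¹` pays for the unfinished sampling interval, since `t < (k + 1) * T`.
  have h4 : ρ ^ k ≤ ρ⁻¹ * Real.exp (-(-Real.log ρ / T * t)) := by
    rw [inv_mul_eq_div, le_div_iff₀ hρ0, ← pow_succ, ← Real.rpow_natCast,
      Real.rpow_def_of_pos hρ0, Real.exp_le_exp]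
    have h5 : t / T ≤ ((k + 1 : ℕ) : ℝ) := by
      rw [div_le_iff₀ hT]; push_cast; exact h2.le
    calc Real.log ρ * ((k + 1 : ℕ) : ℝ) ≤ Real.log ρ * (t / T) :=
          mul_le_mul_of_nonpos_left h5 hlog.le
      _ = _ := by ring
  rw [h3]
  calc _ ≤ C' * (C * ρ ^ k * ‖x‖) := (h _ (sub_nonneg.2 h1) (by linarith) _).trans
        (mul_le_mul_of_nonneg_left (hρ k x) hC')
    _ ≤ C' * (C * (ρ⁻¹ * Real.exp (-(-Real.log ρ / T * t))) * ‖x‖) := by gcongr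
    _ = _ := by ring

theorem exists_tendsto_of_isDCStabilizable {T : ℝ} (hT : 0 < T) (h : IsDCStabilizable S B T) :
    ∃ F : Y →L[𝕜] U,
      Filter.Tendsto (fun n => ‖S.sampledOp B F T ^ n‖) Filter.atTop (nhds 0) := by
  obtain ⟨F, M, ω, hω, hF⟩ := h
  refine ⟨F, ?_⟩
  have hb : ∀ n : ℕ, ‖S.sampledOp B F T ^ n‖ ≤ |M| * Real.exp (-(ω * (n * T))) := fun n => by
    refine ContinuousLinearMap.opNorm_le_bound _ (by positivity) fun x => ?_
    -- Existence is essential: the decay hypothesis only speaks about solutions.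
    obtain ⟨y, hy⟩ := S.exists_solution B hT F x
    rw [← S.solution_eq_pow B hT hy]
    refine (hF x y hy _ (by positivity)).trans ?_
    gcongr
    exact le_abs_self M
  refine squeeze_zero (fun _ => norm_nonneg _) hb ?_
  rw [← mul_zero |M|]
  refine Filter.Tendsto.const_mul _ (Real.tendsto_exp_neg_atTop_nhds_zero.comp ?_)
  exact (tendsto_natCast_atTop_atTop.atTop_mul_const hT).const_mul_atTop hω

/-- At a common time the free terms cancel, and each of the two switching times of an input moves by
at most `n * |T' - T|`. -/
theorem norm_stepResponse_sub_le {R K : ℝ} (hK : ∀ t, 0 ≤ t → t ≤ R → ‖S t‖ ≤ K) {T T' t : ℝ}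
    (hT : 0 ≤ T) (hT' : 0 ≤ T') (ht0 : 0 ≤ t) (htR : t ≤ R) (v : ℕ → Y) (n : ℕ) (x : Y) :
    ‖S.stepResponse T' v n x t - S.stepResponse T v n x t‖ ≤
      |T' - T| * ∑ j ∈ Finset.range n, 2 * K * n * ‖v j‖ := by
  have hR : 0 ≤ R := ht0.trans htR
  have hK0 : 0 ≤ K := (norm_nonneg _).trans (hK 0 le_rfl hR)
  have key : ∀ c : ℝ, 0 ≤ c → c ≤ n → ∀ z : Y,
      ‖S.integralOp (t - c * T') z - S.integralOp (t - c * T) z‖ ≤ |T' - T| * (K * n * ‖z‖) := by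
    intro c hc hcn z
    refine (S.norm_integralOp_sub_apply_le hR hK (by nlinarith) (by nlinarith) z).trans ?_
    have : |t - c * T' - (t - c * T)| = c * |T' - T| := by
      have h : t - c * T' - (t - c * T) = c * (T - T') := by ring
      rw [h, abs_mul, abs_of_nonneg hc, abs_sub_comm]
    rw [this]
    calc K * ‖z‖ * (c * |T' - T|) ≤ K * ‖z‖ * (n * |T' - T|) := by gcongr
      _ = _ := by ring
  rw [stepResponse, stepResponse, add_sub_add_left_eq_sub, ← Finset.sum_sub_distrib,
    Finset.mul_sum]
  refine norm_sum_le_of_le _ fun j hj => ?_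
  have hj' : (j : ℝ) + 1 ≤ n := by exact_mod_cast Finset.mem_range.1 hj
  rw [sub_sub_sub_comm]
  refine (norm_sub_le _ _).trans ((add_le_add (key j (by positivity) (by linarith) (v j))
    (key (j + 1) (by positivity) hj' (v j))).trans_eq ?_)
  ring

/-- A feedback stabilizing at the sampling period `T` yields, for all periods near `T`, an open
loop control that contracts the state in a fixed number of sampling steps. -/
theorem exists_openLoop_contraction {T : ℝ} (hT : 0 < T) (F : Y →L[𝕜] U)
    (hF : Filter.Tendsto (fun n => ‖S.sampledOp B F T ^ n‖) Filter.atTop (nhds 0)) :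
    ∃ G : ℕ → Y →L[𝕜] U, ∃ m : ℕ, 0 < m ∧ ∃ ε : ℝ, 0 < ε ∧ ∀ T' : ℝ, |T' - T| < ε →
      0 < T' ∧ ‖openLoop (S T') ((S.integralOp T').comp B) G m‖ ≤ 1 / 2 := by
  obtain ⟨K, hK0, hK⟩ := S.exists_norm_le (2 * T)
  obtain ⟨n, hn⟩ : ∃ n : ℕ, K * ‖S.sampledOp B F T ^ n‖ ≤ 1 / 4 := by
    have h := hF.const_mul K
    rw [mul_zero] at h
    exact (h.eventually (ge_mem_nhds (by norm_num))).exists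
  set Q := S.sampledOp B F T with hQ
  obtain ⟨K', hK0', hK'⟩ := S.exists_norm_le ((n + 1) * (2 * T))
  set D : ℝ := ∑ j ∈ Finset.range n, 2 * K' * n * ‖(B.comp F).comp (Q ^ j)‖ with hD
  have hD0 : 0 ≤ D := by positivity
  -- The idle step `n` leaves room to compare the two grids at a time beyond `n * T`.
  set G : ℕ → Y →L[𝕜] U := fun j => if j < n then F.comp (Q ^ j) else 0 with hG
  -- The first bound keeps `h = T + (n + 1) * (T' - T)` within `[0, 2 * T]`; the second makes the
  -- switching error at most `1 / 4`.
  refine ⟨G, n + 1, n.succ_pos, min (T / (n + 1)) (1 / (4 * (D + 1))), by positivity,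
    fun T' hT' => ?_⟩
  have h1 : (n + 1) * |T' - T| < T := by
    have := hT'.trans_le (min_le_left _ _)
    rwa [lt_div_iff₀ (by positivity), mul_comm] at this
  have h2 : |T' - T| * D ≤ 1 / 4 := by
    have := (hT'.trans_le (min_le_right _ _)).le
    rw [le_div_iff₀ (by positivity)] at this
    nlinarith [abs_nonneg (T' - T)]
  have h3 : |T' - T| < T := by nlinarith [abs_nonneg (T' - T), (Nat.cast_nonneg n : (0 : ℝ) ≤ n)]
  obtain ⟨h4, h5⟩ := abs_lt.1 h3
  have h6 : |(n + 1) * (T' - T)| < T := by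
    rwa [abs_mul, abs_of_nonneg (by positivity : (0 : ℝ) ≤ n + 1)]
  obtain ⟨h7, h8⟩ := abs_lt.1 h6
  have hT'0 : 0 < T' := by linarith
  refine ⟨hT'0, ContinuousLinearMap.opNorm_le_bound _ (by norm_num) fun x => ?_⟩
  set v : ℕ → Y := fun j => B (F ((Q ^ j) x)) with hv
  set h : ℝ := (n + 1) * T' - n * T with hh
  have hh0 : 0 ≤ h := by linarith
  have hh2 : h ≤ 2 * T := by linarith
  have hnh : n * T + h = (n + 1) * T' := by rw [hh]; ring
  have e1 : openLoop (S T') ((S.integralOp T').comp B) G (n + 1) x =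
      S.stepResponse T' v n x ((n + 1) * T') := by
    rw [S.openLoop_apply_eq_stepResponse B hT'0]
    push_cast
    have h9 : ((n : ℝ) + 1) * T' = n * T' + T' := by ring
    rw [h9, S.stepResponse_succ le_rfl]
    have h10 : B (G n x) = 0 := by simp [hG]
    rw [h10, map_zero, add_zero]
    exact S.stepResponse_congr (fun j hj => by simp [hG, hv, hj]) x
  have e2 : S h ((Q ^ n) x) = S.stepResponse T v n x ((n + 1) * T') := by
    rw [hQ, S.pow_sampledOp_apply_eq_stepResponse B hT, S.apply_stepResponse hT hh0, hnh]
  have e3 := S.norm_stepResponse_sub_le hK' hT.le hT'0.le (t := (n + 1) * T') (by positivity)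
    (by gcongr; linarith) v n x
  have e4 : ∑ j ∈ Finset.range n, 2 * K' * n * ‖v j‖ ≤ D * ‖x‖ := by
    rw [hD, Finset.sum_mul]
    refine Finset.sum_le_sum fun j _ => ?_
    rw [mul_assoc _ ‖_‖ ‖x‖]
    gcongr
    exact ((B.comp F).comp (Q ^ j)).le_opNorm x
  rw [← e1, ← e2] at e3
  have e5 : ‖S h ((Q ^ n) x)‖ ≤ 1 / 4 * ‖x‖ := by
    calc ‖S h ((Q ^ n) x)‖ ≤ K * (‖Q ^ n‖ * ‖x‖) :=
          (S h).le_of_opNorm_le_of_le (hK h hh0 hh2) ((Q ^ n).le_opNorm x)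
      _ = K * ‖Q ^ n‖ * ‖x‖ := by ring
      _ ≤ _ := by gcongr
  have e6 : |T' - T| * ∑ j ∈ Finset.range n, 2 * K' * n * ‖v j‖ ≤ 1 / 4 * ‖x‖ := by
    calc _ ≤ |T' - T| * (D * ‖x‖) := by gcongr
      _ = |T' - T| * D * ‖x‖ := by ring
      _ ≤ _ := by gcongr
  linarith [norm_le_norm_add_norm_sub' (openLoop (S T') ((S.integralOp T').comp B) G (n + 1) x)
    (S h ((Q ^ n) x))]

end C0Semigroup

theorem theorem4p1 {𝕜 Y U : Type*} [RCLike 𝕜]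
    [NormedAddCommGroup Y] [InnerProductSpace 𝕜 Y] [CompleteSpace Y] [NormedSpace ℝ Y]
    [NormedAddCommGroup U] [InnerProductSpace 𝕜 U] [CompleteSpace U]
    (A : Y →ₗ.[𝕜] Y) (S : C0Semigroup 𝕜 Y) (hA : S.IsGeneratedBy A) (B : U →L[𝕜] Y) :
    IsOpen {T : ℝ | 0 < T ∧ IsDCStabilizable S B T} := by
  rw [Metric.isOpen_iff]
  rintro T ⟨hT, hstab⟩
  obtain ⟨F, hF⟩ := S.exists_tendsto_of_isDCStabilizable B hT hstab
  obtain ⟨G, m, hm, ε, hε, h⟩ := S.exists_openLoop_contraction B hT F hF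
  refine ⟨ε, hε, fun T' hT' => ?_⟩
  obtain ⟨hT'0, hc⟩ := h T' hT'
  obtain ⟨F', hF'⟩ := exists_feedback_of_openLoop_contraction _ _ G m hm hc
  exact ⟨hT'0, S.isDCStabilizable_of_tendsto B hT'0 F' hF'⟩
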